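/- All sets are finite, and the sum of sets means the sum modulo 2, that is, the symmetric difference $A+B=(A\cup B)\setminus(A\cap B)$; the empty sum is $\emptyset$. Let $n\ge 0$ and let $K_{n,n}$ be the complete bipartite graph with parts of $n$ vertices each. The *combinatorial deleted square* of a graph $K$ is the set of ordered pairs $(\sigma,\tau)$ of edges of $K$ that have no common vertex. A *cellular 2-cycle* in the deleted square of $K$ is a subset $C$ of it such that for every vertex $a$ and every edge $\beta$ of $K$ the number of edges $\alpha\ni a$ with $(\alpha,\beta)\in C$ is even, and the number of edges $\alpha\ni a$ with $(\beta,\alpha)\in C$ is even. It is *symmetric* if $(\sigma,\tau)\in C$ implies $(\tau,\sigma)\in C$. **Theorem.** Every symmetric cellular 2-cycle in the combinatorial deleted square of $K_{n,n}$ is a sum of finitely many (possibly zero) sets, each of one of the following two kinds: - a symmetrized torus $Q\times R+R\times Q$, where $Q$ and $R$ are the edge sets of two vertex-disjoint simple cycles of length $4$ in $K_{n,n}$; - the combinatorial deleted square of a subgraph of $K_{n,n}$ isomorphic to $K_{3,3}$. -/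

import Mathlib

/-- The combinatorial deleted square of a graph with edge set `E`: the set of cells `(σ, τ)`
where `σ, τ` are non-adjacent edges, that is, edges without a common vertex. -/
def deletedSquare {V : Type*} (E : Set (Sym2 V)) : Set (Sym2 V × Sym2 V) :=
  {p | p.1 ∈ E ∧ p.2 ∈ E ∧ ∀ v : V, v ∈ p.1 → v ∉ p.2}

/-- A cellular 2-cycle in the square `K × K` of a finite graph `K = G`: a set of ordered pairs of
edges such that, for every vertex `a` and edge `β`, the number of edges `α` containing `a` with
`(α, β) ∈ C` is even, and so is the number of those with `(β, α) ∈ C`. -/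
def IsCellularTwoCycle {V : Type*} [Finite V] (G : SimpleGraph V)
    (C : Set (Sym2 V × Sym2 V)) : Prop :=
  C ⊆ G.edgeSet ×ˢ G.edgeSet ∧
    ∀ a : V, ∀ β ∈ G.edgeSet,
      Even {α : Sym2 V | α ∈ G.edgeSet ∧ a ∈ α ∧ (α, β) ∈ C}.ncard ∧
      Even {α : Sym2 V | α ∈ G.edgeSet ∧ a ∈ α ∧ (β, α) ∈ C}.ncard

/-- A set of cells is symmetric if it is preserved by the involution `(x, y) ↦ (y, x)`. -/
def IsSymmetricCellSet {V : Type*} (C : Set (Sym2 V × Sym2 V)) : Prop :=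
  Prod.swap '' C = C

/-- `Q` is the edge set of a simple cycle of length `k` in `G`. -/
def IsSimpleCycleOfLength {V : Type*} (G : SimpleGraph V) (k : ℕ) (Q : Set (Sym2 V)) : Prop :=
  ∃ (v : V) (p : G.Walk v v), p.IsCycle ∧ p.length = k ∧ Q = {e | e ∈ p.edges}

/-- No vertex belongs to both an edge of `Q` and an edge of `R`. -/
def VertexDisjoint {V : Type*} (Q R : Set (Sym2 V)) : Prop :=
  ∀ σ ∈ Q, ∀ τ ∈ R, ∀ v : V, v ∈ σ → v ∉ τ

/-- `T` is the symmetrized torus `Q × R + R × Q` (sum modulo 2) of some vertex-disjoint simple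
cycles `Q, R` of length 4 in `G`. -/
def IsSymmetrizedTorus {V : Type*} (G : SimpleGraph V) (T : Set (Sym2 V × Sym2 V)) : Prop :=
  ∃ Q R : Set (Sym2 V), IsSimpleCycleOfLength G 4 Q ∧ IsSimpleCycleOfLength G 4 R ∧
    VertexDisjoint Q R ∧ T = symmDiff (Q ×ˢ R) (R ×ˢ Q)

/-- `T` is the combinatorial deleted square of some subgraph of `G` isomorphic to `K_{3,3}`. -/
def IsDeletedSquareOfK33 {V : Type*} (G : SimpleGraph V) (T : Set (Sym2 V × Sym2 V)) : Prop :=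
  ∃ H : G.Subgraph, Nonempty (H.coe ≃g completeBipartiteGraph (Fin 3) (Fin 3)) ∧
    T = deletedSquare H.edgeSet

/-- The sum modulo 2 (iterated symmetric difference) of a finite list of sets; the empty sum is
the empty set. -/
def sumModTwo {α : Type*} (L : List (Set α)) : Set α :=
  L.foldr (fun A B => symmDiff A B) ∅

/-!
Write a pair of edges of `K_{n,n}` as `(ij, kl)`, with `i, k` in the first part and `j, l` in the
second, and record a set of such pairs by its indicator function `f i k j l` modulo 2. Reading `f`
as a matrix in `(i, k)` whose entries are matrices in `(j, l)`, the set is a cellular 2-cycle in the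
deleted square precisely if `f` lies in `Z ⊗ Z`, where `Z` is the space of *balanced* matrices: zero
diagonal, and zero row and column sums. Exchanging the two edges transposes both factors, so a
symmetric cycle is an invariant of `τ ⊗ τ`, where `τ` is the transposition on `Z`.

Two kinds of elements of `Z` matter: the rectangle, the indicator matrix of `{a, b} × {c, d}` with
`a, b, c, d` distinct, and the hexagon, the indicator matrix of the off-diagonal positions in
`{a, b, c} × {a, b, c}`. A symmetrized torus is `x ⊗ y + τx ⊗ τy` for two rectangles `x, y`, and
the deleted square of a `K_{3,3}` is the product of two hexagons. They are related by the identity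
that a rectangle plus its transpose is a sum of two hexagons (`rect_add_transpose`).

Fix distinct `p, q, r`. There is a set `S` of positions, disjoint from its transpose, and for each
`s ∈ S` a sum of rectangles `z_s` that is dual to `s` with respect to `S` and its transpose, such
that a balanced matrix vanishing on `S` and on its transpose is a multiple of the hexagon `h` on
`p, q, r`. Hence a balanced matrix `c`, with entries in any vector space over the field of two
elements, equals `∑ s ∈ S, (z_s ⊗ c(s) + τz_s ⊗ c(τs)) + h ⊗ v` for some `v`
(`exists_eq_sum_basisCycle`). For `c = f` invariant, `f(τs) = τ f(s)`, so the summands are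
symmetrizations of `z_s ⊗ f(s)`, and `v` is a symmetric balanced matrix.

The summands are generated: expanding `f(s)` as a sum of rectangles and a multiple of `h` gives
symmetrized tori and terms `(z_s + τz_s) ⊗ h`, which are sums of products of hexagons
(`symmTensor_mem_generated`). The remaining term is generated because the expansion of the symmetric
matrix `v` groups into terms `z_s + τz_s` and `h`, so that `v` is a sum of hexagons
(`mem_hexSpan_of_symm`). For `n ≤ 2` there are no `p, q, r`, but then `Z = 0`.
-/

namespace K33Tori

open Finset

/-! ### Balanced matrices, rectangles and hexagons -/

/-- The indicator function of a point, with values modulo 2. -/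
def ind {α : Type*} [DecidableEq α] (a i : α) : ZMod 2 := if i = a then 1 else 0

/-- The indicator matrix of `{a, b} × {c, d}` (for `a ≠ b` and `c ≠ d`). -/
def rect {α : Type*} [DecidableEq α] (a b c d : α) : α → α → ZMod 2 := fun i k =>
  (ind a i + ind b i) * (ind c k + ind d k)

/-- The indicator matrix of the six off-diagonal positions of `{a, b, c} × {a, b, c}`
(for distinct `a, b, c`), written as a polynomial so that identities between such matrices hold
formally. -/
def hexagon {α : Type*} [DecidableEq α] (a b c : α) : α → α → ZMod 2 := fun i k =>
  (ind a i + ind b i + ind c i) * (ind a k + ind b k + ind c k)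
    + ind a i * ind a k + ind b i * ind b k + ind c i * ind c k

/-- Matrices with zero diagonal all of whose rows and columns have sum zero. -/
def balanced (α V : Type*) [Fintype α] [AddCommGroup V] : AddSubgroup (α → α → V) where
  carrier := {c | (∀ i, c i i = 0) ∧ (∀ i, ∑ k, c i k = 0) ∧ ∀ k, ∑ i, c i k = 0}
  zero_mem' := by simp
  add_mem' := by
    rintro c d ⟨h₁, h₂, h₃⟩ ⟨g₁, g₂, g₃⟩
    simp [sum_add_distrib, *]
  neg_mem' := by
    rintro c ⟨h₁, h₂, h₃⟩
    simp [*]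

/-- The matrices spanned by the indicators of `{a, b} × {c, d}` for distinct `a, b, c, d`. -/
def rectSpan (α : Type*) [DecidableEq α] : AddSubgroup (α → α → ZMod 2) :=
  AddSubgroup.closure {x | ∃ a b c d, [a, b, c, d].Nodup ∧ x = rect a b c d}

/-- The matrices spanned by the hexagons on distinct `a, b, c`. -/
def hexSpan (α : Type*) [DecidableEq α] : AddSubgroup (α → α → ZMod 2) :=
  AddSubgroup.closure {x | ∃ a b c, [a, b, c].Nodup ∧ x = hexagon a b c}

section Algebra

variable {α : Type*}

lemma transpose_mem_balanced {V : Type*} [Fintype α] [AddCommGroup V] {c : α → α → V}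
    (hc : c ∈ balanced α V) : (fun i k => c k i) ∈ balanced α V :=
  ⟨hc.1, hc.2.2, hc.2.1⟩

lemma smul_mem_balanced {V : Type*} [Fintype α] [AddCommGroup V] [Module (ZMod 2) V]
    {z : α → α → ZMod 2} (hz : z ∈ balanced α (ZMod 2)) (v : V) :
    (fun i k => z i k • v) ∈ balanced α V := by
  obtain ⟨h₁, h₂, h₃⟩ := hz
  refine ⟨fun i => by simp [h₁], fun i => ?_, fun k => ?_⟩
  · rw [← sum_smul, h₂, zero_smul]
  · rw [← sum_smul, h₃, zero_smul]

variable [DecidableEq α]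

lemma sum_ind [Fintype α] (a : α) : ∑ i, ind a i = 1 := by simp [ind]

lemma rect_mem_balanced [Fintype α] {a b c d : α} (h : [a, b, c, d].Nodup) :
    rect a b c d ∈ balanced α (ZMod 2) := by
  have h2 : (1 : ZMod 2) + 1 = 0 := by decide
  refine ⟨fun i => ?_, fun i => ?_, fun k => ?_⟩
  · simp only [List.nodup_cons, List.mem_cons] at h
    unfold rect ind
    grind
  · simp [rect, ← mul_sum, sum_add_distrib, sum_ind, h2]
  · simp [rect, ← sum_mul, sum_add_distrib, sum_ind, h2]

lemma rectSpan_le_balanced [Fintype α] : rectSpan α ≤ balanced α (ZMod 2) := by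
  rw [rectSpan, AddSubgroup.closure_le]
  rintro _ ⟨a, b, c, d, h, rfl⟩
  exact rect_mem_balanced h

lemma hexagon_symm (a b c i k : α) : hexagon a b c i k = hexagon a b c k i := by
  unfold hexagon; ring

/-- Two hexagons sharing two of their three vertices differ by a symmetrized rectangle. -/
lemma rect_add_transpose (a b c d i k : α) :
    rect a b c d i k + rect a b c d k i = hexagon a b c i k + hexagon a b d i k := by
  have h2 : (2 : ZMod 2) = 0 := by decide
  unfold rect hexagon
  linear_combination -(ind a i * ind b k + ind b i * ind a k + 2 * ind a i * ind a k +
    2 * ind b i * ind b k + ind c i * ind c k + ind d i * ind d k) * h2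

lemma add_transpose_mem_hexSpan {x : α → α → ZMod 2} (hx : x ∈ rectSpan α) :
    (fun i k => x i k + x k i) ∈ hexSpan α := by
  induction hx using AddSubgroup.closure_induction with
  | mem x hx =>
    obtain ⟨a, b, c, d, h, rfl⟩ := hx
    simp only [rect_add_transpose]
    simp only [List.nodup_cons, List.mem_cons, List.not_mem_nil] at h
    have key : ∀ {a b c : α}, [a, b, c].Nodup → hexagon a b c ∈ hexSpan α :=
      fun h => AddSubgroup.subset_closure ⟨_, _, _, h, rfl⟩
    exact add_mem (key (a := a) (b := b) (c := c) (by simp; grind))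
      (key (a := a) (b := b) (c := d) (by simp; grind))
  | zero =>
    simp only [Pi.zero_apply, add_zero]
    exact zero_mem (hexSpan α)
  | add x y _ _ hx hy =>
    convert add_mem hx hy using 1
    ext i k
    simp only [Pi.add_apply]
    ring
  | neg x _ hx =>
    convert neg_mem hx using 1
    ext i k
    simp only [Pi.neg_apply]
    ring

end Algebra

/-! ### Expansion of a balanced matrix in rectangles and one hexagon -/

section Expansion

variable {α : Type*} [Fintype α] [LinearOrder α]

/-- Together with their transposes, the positions at which a balanced matrix is determined up to
adding a multiple of `hexagon p q r`: the off-diagonal positions outside this hexagon and outside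
the row and the column of `p` form the union of this set and its transpose. -/
def basisCells (p q r : α) : Finset (α × α) :=
  {s | (s.2 ≠ p ∧ s.2 ≠ q ∧ s.2 ≠ r) ∧
    (s.1 = q ∨ s.1 = r ∨ (s.1 ≠ p ∧ s.1 ≠ q ∧ s.1 ≠ r ∧ s.1 < s.2))}

/-- The balanced matrix dual to a position `s ∈ basisCells p q r`: its entry at `s` is one, and its
entries at the other positions of `basisCells p q r` and of the transpose are zero. A position
`(q, k)` or `(r, k)` is completed to a rectangle by entries in the row of `p` and in the hexagon; for
other positions `(i, k)` a sum of two rectangles is needed, so that `(i, r)` cancels. -/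
def basisCycle (p q r : α) (s : α × α) : α → α → ZMod 2 :=
  if s.1 = q then rect q p s.2 r
  else if s.1 = r then rect r p s.2 q
  else rect s.1 q p r + rect s.1 p r s.2

lemma basisCycle_apply {p q r : α} (hpqr : [p, q, r].Nodup) {s t : α × α}
    (hs : s ∈ basisCells p q r) (ht : t ∈ basisCells p q r) :
    basisCycle p q r s t.1 t.2 = if s = t then 1 else 0 := by
  obtain ⟨i, k⟩ := s
  obtain ⟨i', k'⟩ := t
  simp only [basisCells, mem_filter, mem_univ, true_and] at hs ht
  simp only [List.nodup_cons, List.mem_cons, List.not_mem_nil] at hpqr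
  simp only [basisCycle, Prod.mk.injEq]
  split_ifs <;> simp only [rect, ind, Pi.add_apply] <;> grind

lemma basisCycle_apply_swap {p q r : α} (hpqr : [p, q, r].Nodup) {s t : α × α}
    (hs : s ∈ basisCells p q r) (ht : t ∈ basisCells p q r) :
    basisCycle p q r s t.2 t.1 = 0 := by
  obtain ⟨i, k⟩ := s
  obtain ⟨i', k'⟩ := t
  simp only [basisCells, mem_filter, mem_univ, true_and] at hs ht
  simp only [List.nodup_cons, List.mem_cons, List.not_mem_nil] at hpqr
  simp only [basisCycle]
  split_ifs <;> simp only [rect, ind, Pi.add_apply] <;> grind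

lemma basisCycle_mem_rectSpan {p q r : α} (hpqr : [p, q, r].Nodup) {s : α × α}
    (hs : s ∈ basisCells p q r) : basisCycle p q r s ∈ rectSpan α := by
  obtain ⟨i, k⟩ := s
  simp only [basisCells, mem_filter, mem_univ, true_and] at hs
  simp only [List.nodup_cons, List.mem_cons, List.not_mem_nil] at hpqr
  have key : ∀ {a b c d : α}, [a, b, c, d].Nodup → rect a b c d ∈ rectSpan α :=
    fun h => AddSubgroup.subset_closure ⟨_, _, _, _, h, rfl⟩
  unfold basisCycle
  split_ifs
  · exact key (by simp; grind)
  · exact key (by simp; grind)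
  · exact add_mem (key (by simp; grind)) (key (by simp; grind))

variable {V : Type*} [AddCommGroup V]

/-- A row outside the hexagon vanishes: only its entry in column `p` is not prescribed, and this
entry is the sum of the others. -/
lemma row_eq_zero {p q r : α} {d : α → α → V}
    (hd : d ∈ balanced α V) (h₁ : ∀ s ∈ basisCells p q r, d s.1 s.2 = 0)
    (h₂ : ∀ s ∈ basisCells p q r, d s.2 s.1 = 0) {i : α} (hp : i ≠ p) (hq : i ≠ q) (hr : i ≠ r)
    (k : α) : d i k = 0 := by
  have key : ∀ k, k ≠ p → d i k = 0 := by
    intro k hk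
    by_cases hkq : k = q
    · exact h₂ (k, i) (by simp [basisCells]; grind)
    by_cases hkr : k = r
    · exact h₂ (k, i) (by simp [basisCells]; grind)
    rcases lt_trichotomy i k with h | h | h
    · exact h₁ (i, k) (by simp [basisCells]; grind)
    · rw [← h]; exact hd.1 i
    · exact h₂ (k, i) (by simp [basisCells]; grind)
  by_cases hk : k = p
  · have := hd.2.1 i
    rwa [Fintype.sum_eq_single p (fun k hk => key k hk), ← hk] at this
  · exact key k hk

variable [Module (ZMod 2) V]

/-- A balanced matrix vanishing on `basisCells p q r` and on its transpose is a multiple of the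
hexagon. -/
lemma eq_smul_hexagon {p q r : α} (hpqr : [p, q, r].Nodup) {d : α → α → V}
    (hd : d ∈ balanced α V) (h₁ : ∀ s ∈ basisCells p q r, d s.1 s.2 = 0)
    (h₂ : ∀ s ∈ basisCells p q r, d s.2 s.1 = 0) (i k : α) :
    d i k = hexagon p q r i k • d p q := by
  have hrow : ∀ i k, i ≠ p → i ≠ q → i ≠ r → d i k = 0 := fun i k hp hq hr =>
    row_eq_zero hd h₁ h₂ hp hq hr k
  have hcol : ∀ i k, k ≠ p → k ≠ q → k ≠ r → d i k = 0 := fun i k hp hq hr =>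
    row_eq_zero (transpose_mem_balanced hd) h₂ h₁ hp hq hr i
  have hpq : p ≠ q := by simp at hpqr; grind
  have hpr : p ≠ r := by simp at hpqr; grind
  have hqr : q ≠ r := by simp at hpqr; grind
  have sum3 : ∀ f : α → V, (∀ x, x ≠ p → x ≠ q → x ≠ r → f x = 0) →
      ∑ x, f x = f p + (f q + f r) := by
    intro f hf
    rw [← sum_subset (subset_univ {p, q, r}) (fun x _ hx => by
      simp only [mem_insert, mem_singleton, not_or] at hx
      exact hf x hx.1 hx.2.1 hx.2.2)]
    rw [sum_insert (by simp [hpq, hpr]), sum_insert (by simp [hqr]), sum_singleton]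
  -- Only the six off-diagonal entries of the block on `p, q, r` are left; each row and each
  -- column of it contains two of them, which are therefore equal.
  have hR : ∀ i, d i p + (d i q + d i r) = 0 := fun i => by
    rw [← sum3 _ fun x => hcol i x, hd.2.1]
  have hC : ∀ k, d p k + (d q k + d r k) = 0 := fun k => by
    rw [← sum3 (fun i => d i k) fun x => hrow x k, hd.2.2]
  have hE : ∀ {x y : V}, x + y = 0 → y = x := fun {x y} h => by
    rw [← sub_eq_zero, ZModModule.sub_eq_add, add_comm, h]
  have e₁ : d p r = d p q := hE (by simpa [hd.1] using hR p)
  have e₂ : d q r = d p r := hE (by simpa [hd.1] using hC r)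
  have e₃ : d q r = d q p := hE (by simpa [hd.1] using hR q)
  have e₄ : d r p = d q p := hE (by simpa [hd.1] using hC p)
  have e₅ : d r q = d r p := hE (by simpa [hd.1] using hR r)
  have hself : ∀ x, d x x = 0 := hd.1
  by_cases hi : i ∈ [p, q, r]
  · by_cases hk : k ∈ [p, q, r]
    · simp only [List.mem_cons, List.not_mem_nil, or_false] at hi hk
      have h11 : (1 : ZMod 2) + 1 = 0 := by decide
      rcases hi with rfl | rfl | rfl <;> rcases hk with rfl | rfl | rfl <;>
        simp [hexagon, ind, hpq, hpr, hqr, hpq.symm, hpr.symm, hqr.symm, hself, h11, e₁, ← e₃, e₂,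
          e₄, e₅]
    · simp only [List.mem_cons, List.not_mem_nil, or_false, not_or] at hk
      rw [hcol i k hk.1 hk.2.1 hk.2.2]
      simp [hexagon, ind, hk]
  · simp only [List.mem_cons, List.not_mem_nil, or_false, not_or] at hi
    rw [hrow i k hi.1 hi.2.1 hi.2.2]
    simp [hexagon, ind, hi]

/-- Every balanced matrix is a combination of the dual matrices `basisCycle p q r s`, their
transposes, and one hexagon. -/
lemma exists_eq_sum_basisCycle {p q r : α} (hpqr : [p, q, r].Nodup) {c : α → α → V}
    (hc : c ∈ balanced α V) :
    ∃ v : V, ∀ i k, c i k = ∑ s ∈ basisCells p q r,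
      (basisCycle p q r s i k • c s.1 s.2 + basisCycle p q r s k i • c s.2 s.1)
        + hexagon p q r i k • v := by
  set d : α → α → V := c - ∑ s ∈ basisCells p q r,
    ((fun i k => basisCycle p q r s i k • c s.1 s.2) +
      fun i k => basisCycle p q r s k i • c s.2 s.1) with hd
  have hz : ∀ s ∈ basisCells p q r, basisCycle p q r s ∈ balanced α (ZMod 2) := fun s hs =>
    rectSpan_le_balanced (basisCycle_mem_rectSpan hpqr hs)
  have hdb : d ∈ balanced α V := sub_mem hc <| sum_mem fun s hs =>
    add_mem (smul_mem_balanced (hz s hs) _)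
      (smul_mem_balanced (transpose_mem_balanced (hz s hs)) _)
  have hda : ∀ i k, d i k = c i k - ∑ s ∈ basisCells p q r,
      (basisCycle p q r s i k • c s.1 s.2 + basisCycle p q r s k i • c s.2 s.1) := by
    intro i k
    simp [hd, Finset.sum_apply]
  refine ⟨d p q, fun i k => ?_⟩
  rw [← eq_smul_hexagon hpqr hdb, hda, add_sub_cancel]
  · intro t ht
    rw [hda, sum_eq_single_of_mem t ht, basisCycle_apply hpqr ht ht,
      basisCycle_apply_swap hpqr ht ht]
    · simp
    · intro s hs hst
      rw [basisCycle_apply hpqr hs ht, basisCycle_apply_swap hpqr hs ht]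
      simp [hst]
  · intro t ht
    rw [hda, sum_eq_single_of_mem t ht, basisCycle_apply hpqr ht ht,
      basisCycle_apply_swap hpqr ht ht]
    · simp
    · intro s hs hst
      rw [basisCycle_apply hpqr hs ht, basisCycle_apply_swap hpqr hs ht]
      simp [hst]

end Expansion

/-! ### Generation of the invariants of the tensor square -/

/-- The functions on quadruples `(i, k, j, l)` spanned by symmetrized tori, which are the
symmetrizations of products of two rectangles, and by deleted squares of `K_{3,3}`, which are
products of two hexagons. -/
def generated (α : Type*) [DecidableEq α] : AddSubgroup (α → α → α → α → ZMod 2) :=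
  AddSubgroup.closure
    ({f | ∃ a b c d, [a, b, c, d].Nodup ∧ ∃ a' b' c' d', [a', b', c', d'].Nodup ∧
        f = fun i k j l => rect a b c d i k * rect a' b' c' d' j l +
          rect a b c d k i * rect a' b' c' d' l j} ∪
      {f | ∃ a b c, [a, b, c].Nodup ∧ ∃ a' b' c', [a', b', c'].Nodup ∧
        f = fun i k j l => hexagon a b c i k * hexagon a' b' c' j l})

/-- The product of two matrices as a function on quadruples, additive in both factors. -/
def tensor {α : Type*} :
    (α → α → ZMod 2) →+ (α → α → ZMod 2) →+ (α → α → α → α → ZMod 2) :=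
  AddMonoidHom.mk' (fun x => AddMonoidHom.mk' (fun y i k j l => x i k * y j l)
    fun y y' => by ext; simp [mul_add]) fun x x' => by ext; simp [add_mul]

/-- The sum of the product of two matrices and the product of their transposes. -/
def symmTensor {α : Type*} :
    (α → α → ZMod 2) →+ (α → α → ZMod 2) →+ (α → α → α → α → ZMod 2) :=
  AddMonoidHom.mk' (fun x =>
    AddMonoidHom.mk' (fun y i k j l => x i k * y j l + x k i * y l j)
      fun y y' => by ext; simp only [Pi.add_apply]; ring)
    fun x x' => by
      ext
      simp only [Pi.add_apply, AddMonoidHom.add_apply, AddMonoidHom.mk'_apply]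
      ring

section Algebra

variable {α : Type*}

@[simp] lemma tensor_apply (x y : α → α → ZMod 2) (i k j l : α) :
    tensor x y i k j l = x i k * y j l := rfl

@[simp] lemma symmTensor_apply (x y : α → α → ZMod 2) (i k j l : α) :
    symmTensor x y i k j l = x i k * y j l + x k i * y l j := rfl

lemma biadditive_mem {A B M : Type*} [AddCommGroup A] [AddCommGroup B] [AddCommGroup M]
    (F : A →+ B →+ M) {S : Set A} {T : Set B} {G : AddSubgroup M}
    (h : ∀ x ∈ S, ∀ y ∈ T, F x y ∈ G) {x : A} {y : B} (hx : x ∈ AddSubgroup.closure S)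
    (hy : y ∈ AddSubgroup.closure T) : F x y ∈ G := by
  have h₁ : ∀ x ∈ S, F x y ∈ G := fun x hx =>
    (AddSubgroup.closure_le (G.comap (F x))).2 (h x hx) hy
  exact (AddSubgroup.closure_le (G.comap (F.flip y))).2 h₁ hx

lemma smul_mem_of_mem {M : Type*} [AddCommGroup M] [Module (ZMod 2) M] {G : AddSubgroup M}
    (a : ZMod 2) {x : M} (hx : x ∈ G) : a • x ∈ G := by
  obtain rfl | rfl : a = 0 ∨ a = 1 := by revert a; decide
  · rw [zero_smul]; exact zero_mem G
  · rwa [one_smul]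

/-- With at most two indices, a row has at most one off-diagonal entry, which is its sum. -/
lemma eq_zero_of_card_le_two [Fintype α] (hα : Fintype.card α ≤ 2) {V : Type*} [AddCommGroup V]
    {c : α → α → V} (hc : c ∈ balanced α V) : c = 0 := by
  classical
  ext i k
  by_cases hik : i = k
  · rw [hik]; exact hc.1 k
  · have huniv : ({i, k} : Finset α) = univ :=
      eq_univ_of_card _ (le_antisymm (card_le_univ _) (by rwa [card_pair hik]))
    have := hc.2.1 i
    rwa [← huniv, sum_pair hik, hc.1 i, zero_add] at this

variable [DecidableEq α]

lemma transpose_mem_rectSpan {x : α → α → ZMod 2} (hx : x ∈ rectSpan α) :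
    (fun i k => x k i) ∈ rectSpan α := by
  induction hx using AddSubgroup.closure_induction with
  | mem x hx =>
    obtain ⟨a, b, c, d, h, rfl⟩ := hx
    refine AddSubgroup.subset_closure ⟨c, d, a, b, ?_, ?_⟩
    · simp only [List.nodup_cons, List.mem_cons, List.not_mem_nil] at h ⊢
      grind
    · ext i k
      exact mul_comm _ _
  | zero => exact zero_mem (rectSpan α)
  | add x y _ _ hx hy => exact add_mem hx hy
  | neg x _ hx => exact neg_mem hx

lemma hexagon_mem_hexSpan {a b c : α} (h : [a, b, c].Nodup) : hexagon a b c ∈ hexSpan α :=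
  AddSubgroup.subset_closure ⟨a, b, c, h, rfl⟩

lemma hexagon_apply {p q r : α} (hpqr : [p, q, r].Nodup) : hexagon p q r p q = 1 := by
  simp only [List.nodup_cons, List.mem_cons, List.not_mem_nil] at hpqr
  unfold hexagon ind
  grind

lemma tensor_mem_generated {x y : α → α → ZMod 2} (hx : x ∈ hexSpan α) (hy : y ∈ hexSpan α) :
    tensor x y ∈ generated α := by
  refine biadditive_mem tensor ?_ hx hy
  rintro _ ⟨a, b, c, h, rfl⟩ _ ⟨a', b', c', h', rfl⟩
  exact AddSubgroup.subset_closure (Or.inr ⟨a, b, c, h, a', b', c', h', rfl⟩)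

end Algebra

section Order

variable {α : Type*} [Fintype α] [LinearOrder α]

/-- A symmetric balanced matrix is a sum of hexagons: its expansion groups into sums of the
matrices `basisCycle p q r s` with their transposes. -/
lemma mem_hexSpan_of_symm {p q r : α} (hpqr : [p, q, r].Nodup) {v : α → α → ZMod 2}
    (hv : v ∈ balanced α (ZMod 2)) (hsymm : ∀ i k, v i k = v k i) : v ∈ hexSpan α := by
  obtain ⟨w, hw⟩ := exists_eq_sum_basisCycle hpqr hv
  have : v = ∑ s ∈ basisCells p q r, v s.1 s.2 •
      (fun i k => basisCycle p q r s i k + basisCycle p q r s k i) + w • hexagon p q r := by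
    ext i k
    rw [hw i k]
    simp only [Pi.add_apply, Finset.sum_apply, Pi.smul_apply, smul_eq_mul, mul_comm w]
    congr 1
    refine sum_congr rfl fun s _ => ?_
    rw [hsymm s.2 s.1]
    ring
  rw [this]
  exact add_mem (sum_mem fun s hs => smul_mem_of_mem _
    (add_transpose_mem_hexSpan (basisCycle_mem_rectSpan hpqr hs)))
    (smul_mem_of_mem _ (hexagon_mem_hexSpan hpqr))

/-- The expansion of a balanced matrix, with its part from rectangles collected. -/
lemma exists_eq_add_smul_hexagon {p q r : α} (hpqr : [p, q, r].Nodup) {y : α → α → ZMod 2}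
    (hy : y ∈ balanced α (ZMod 2)) :
    ∃ z ∈ rectSpan α, ∃ w : ZMod 2, y = z + w • hexagon p q r := by
  obtain ⟨w, hw⟩ := exists_eq_sum_basisCycle hpqr hy
  refine ⟨∑ s ∈ basisCells p q r, (y s.1 s.2 • basisCycle p q r s +
    y s.2 s.1 • fun i k => basisCycle p q r s k i), sum_mem fun s hs => ?_, w, ?_⟩
  · have hz := basisCycle_mem_rectSpan hpqr hs
    exact add_mem (smul_mem_of_mem _ hz) (smul_mem_of_mem _ (transpose_mem_rectSpan hz))
  · ext i k
    rw [hw i k]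
    simp only [Pi.add_apply, Finset.sum_apply, Pi.smul_apply, smul_eq_mul, mul_comm]

/-- For `x` a sum of rectangles and `y` balanced, the symmetrized product of `x` and `y` is
generated: if `y` is a rectangle this is a sum of symmetrized tori, and if `y` is a hexagon it is
the product of the sum of hexagons `x + xᵀ` and of `y`. -/
lemma symmTensor_mem_generated {p q r : α} (hpqr : [p, q, r].Nodup) {x y : α → α → ZMod 2}
    (hx : x ∈ rectSpan α) (hy : y ∈ balanced α (ZMod 2)) : symmTensor x y ∈ generated α := by
  obtain ⟨z, hz, w, rfl⟩ := exists_eq_add_smul_hexagon hpqr hy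
  rw [map_add]
  refine add_mem (biadditive_mem symmTensor ?_ hx hz) ?_
  · rintro _ ⟨a, b, c, d, h, rfl⟩ _ ⟨a', b', c', d', h', rfl⟩
    exact AddSubgroup.subset_closure (Or.inl ⟨a, b, c, d, h, a', b', c', d', h', rfl⟩)
  · convert tensor_mem_generated (add_transpose_mem_hexSpan hx)
      (smul_mem_of_mem w (hexagon_mem_hexSpan hpqr)) using 1
    ext i k j l
    simp only [symmTensor_apply, tensor_apply, Pi.smul_apply, hexagon_symm p q r l j]
    ring

/-- A function in the tensor square of the balanced matrices that is invariant under transposing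
both factors is generated. -/
theorem mem_generated {f : α → α → α → α → ZMod 2}
    (hf : f ∈ balanced α (α → α → ZMod 2)) (hfi : ∀ i k, f i k ∈ balanced α (ZMod 2))
    (hsymm : ∀ i k j l, f i k j l = f k i l j) : f ∈ generated α := by
  rcases le_or_gt (Fintype.card α) 2 with hα | hα
  · rw [eq_zero_of_card_le_two hα hf]
    exact zero_mem _
  obtain ⟨p, q, r, hpq, hpr, hqr⟩ := Fintype.two_lt_card_iff.1 hα
  have hpqr : [p, q, r].Nodup := by simp [hpq, hpr, hqr]
  obtain ⟨v, hv⟩ := exists_eq_sum_basisCycle hpqr hf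
  have hzb : ∀ s ∈ basisCells p q r, basisCycle p q r s ∈ rectSpan α := fun s hs =>
    basisCycle_mem_rectSpan hpqr hs
  -- The position `(p, q)` lies in the hexagon, so `v` is a combination of entries of `f`.
  have hvb : v ∈ balanced α (ZMod 2) := by
    have h := hv p q
    rw [hexagon_apply hpqr, one_smul, ← sub_eq_iff_eq_add'] at h
    rw [← h]
    exact sub_mem (hfi p q) <| sum_mem fun s _ =>
      add_mem (smul_mem_of_mem _ (hfi _ _)) (smul_mem_of_mem _ (hfi _ _))
  -- Comparing the expansions at `(p, q)` and `(q, p)`: the sums are transposes of each other.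
  have hvs : ∀ j l, v j l = v l j := by
    intro j l
    have h₁ := congrFun₂ (hv p q) j l
    have h₂ := congrFun₂ (hv q p) l j
    rw [hexagon_symm p q r q p] at h₂
    simp only [hexagon_apply hpqr, one_smul, Pi.add_apply, Finset.sum_apply, Pi.smul_apply,
      smul_eq_mul] at h₁ h₂
    rw [hsymm q p l j, h₁] at h₂
    convert add_left_cancel (h₂.trans (congrArg (· + v l j) (sum_congr rfl fun s _ => ?_))) using 1
    rw [hsymm s.2 s.1 l j, hsymm s.1 s.2 l j, add_comm]
  have hsum : f = ∑ s ∈ basisCells p q r, symmTensor (basisCycle p q r s) (f s.1 s.2) +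
      tensor (hexagon p q r) v := by
    ext i k j l
    have h := congrFun₂ (hv i k) j l
    simp only [Pi.add_apply, Finset.sum_apply, Pi.smul_apply, smul_eq_mul] at h
    simp only [Pi.add_apply, Finset.sum_apply, symmTensor_apply, tensor_apply]
    rw [h]
    congr 1
    refine sum_congr rfl fun s _ => ?_
    rw [hsymm s.2 s.1]
  rw [hsum]
  exact add_mem (sum_mem fun s hs => symmTensor_mem_generated hpqr (hzb s hs) (hfi _ _))
    (tensor_mem_generated (hexagon_mem_hexSpan hpqr) (mem_hexSpan_of_symm hpqr hvb hvs))

end Order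

/-! ### Pairs of edges of the complete bipartite graph -/

/-- The edge of the complete bipartite graph joining the vertex `i` of the first part to the
vertex `j` of the second part. -/
def edge {α : Type*} (i j : α) : Sym2 (α ⊕ α) := s(Sum.inl i, Sum.inr j)

/-- The set of pairs of edges with indicator function `f`: the value `f i k j l` records whether
the pair of the edges from `i` to `j` and from `k` to `l` belongs to the set. -/
def cells {α : Type*} (f : α → α → α → α → ZMod 2) : Set (Sym2 (α ⊕ α) × Sym2 (α ⊕ α)) :=
  {p | ∃ i k j l, p = (edge i j, edge k l) ∧ f i k j l = 1}

/-- The edges joining `{a, b}` in the first part to `{c, d}` in the second part; for `a ≠ b` and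
`c ≠ d` they form a cycle of length four. -/
def box {α : Type*} (a b c d : α) : Set (Sym2 (α ⊕ α)) :=
  {e | ∃ i j, (i = a ∨ i = b) ∧ (j = c ∨ j = d) ∧ e = edge i j}

section Graph

variable {α : Type*}

@[simp] lemma edge_inj {i j k l : α} : edge i j = edge k l ↔ i = k ∧ j = l := by
  simp [edge]

@[simp] lemma inl_mem_edge {a i j : α} : Sum.inl a ∈ edge i j ↔ a = i := by simp [edge]

@[simp] lemma inr_mem_edge {a i j : α} : Sum.inr a ∈ edge i j ↔ a = j := by simp [edge]

lemma mem_edgeSet_iff {e : Sym2 (α ⊕ α)} :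
    e ∈ (completeBipartiteGraph α α).edgeSet ↔ ∃ i j, e = edge i j := by
  induction e using Sym2.ind with
  | _ x y => rcases x with x | x <;> rcases y with y | y <;> simp [edge]

lemma edge_mem_edgeSet (i j : α) : edge i j ∈ (completeBipartiteGraph α α).edgeSet :=
  mem_edgeSet_iff.2 ⟨i, j, rfl⟩

@[simp] lemma mem_cells {f : α → α → α → α → ZMod 2} {i k j l : α} :
    (edge i j, edge k l) ∈ cells f ↔ f i k j l = 1 := by
  constructor
  · rintro ⟨i', k', j', l', h, hf⟩
    simp only [Prod.mk.injEq, edge_inj] at h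
    obtain ⟨⟨rfl, rfl⟩, rfl, rfl⟩ := h
    exact hf
  · exact fun h => ⟨i, k, j, l, rfl, h⟩

lemma cells_subset (f : α → α → α → α → ZMod 2) :
    cells f ⊆ (completeBipartiteGraph α α).edgeSet ×ˢ (completeBipartiteGraph α α).edgeSet := by
  rintro _ ⟨i, k, j, l, rfl, -⟩
  exact ⟨edge_mem_edgeSet i j, edge_mem_edgeSet k l⟩

/-- Sets of pairs of edges are equal if they have the same pairs `(ij, kl)`. -/
lemma eq_of_edges {A B : Set (Sym2 (α ⊕ α) × Sym2 (α ⊕ α))}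
    (hA : A ⊆ (completeBipartiteGraph α α).edgeSet ×ˢ (completeBipartiteGraph α α).edgeSet)
    (hB : B ⊆ (completeBipartiteGraph α α).edgeSet ×ˢ (completeBipartiteGraph α α).edgeSet)
    (h : ∀ i k j l, (edge i j, edge k l) ∈ A ↔ (edge i j, edge k l) ∈ B) : A = B := by
  have key : ∀ p ∈ (completeBipartiteGraph α α).edgeSet ×ˢ (completeBipartiteGraph α α).edgeSet,
      p ∈ A ↔ p ∈ B := by
    rintro ⟨σ, τ⟩ ⟨hσ, hτ⟩
    obtain ⟨i, j, rfl⟩ := mem_edgeSet_iff.1 hσ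
    obtain ⟨k, l, rfl⟩ := mem_edgeSet_iff.1 hτ
    exact h i k j l
  ext p
  exact ⟨fun hp => (key p (hA hp)).1 hp, fun hp => (key p (hB hp)).2 hp⟩

lemma cells_zero : cells (0 : α → α → α → α → ZMod 2) = ∅ := by
  ext p
  simp [cells]

lemma cells_add (f g : α → α → α → α → ZMod 2) :
    cells (f + g) = symmDiff (cells f) (cells g) := by
  refine eq_of_edges (cells_subset _) ?_ fun i k j l => ?_
  · exact Set.symmDiff_subset_union.trans (Set.union_subset (cells_subset f) (cells_subset g))
  · simp only [Set.mem_symmDiff, mem_cells, Pi.add_apply]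
    generalize f i k j l = x
    generalize g i k j l = y
    revert x y
    decide

lemma sumModTwo_append {β : Type*} (L M : List (Set β)) :
    sumModTwo (L ++ M) = symmDiff (sumModTwo L) (sumModTwo M) := by
  induction L with
  | nil => exact (bot_symmDiff _).symm
  | cons A L ih =>
    change symmDiff A (sumModTwo (L ++ M)) = symmDiff (symmDiff A (sumModTwo L)) _
    rw [ih, symmDiff_assoc]

@[simp] lemma edge_mem_box {a b c d i j : α} :
    edge i j ∈ box a b c d ↔ (i = a ∨ i = b) ∧ (j = c ∨ j = d) := by
  constructor
  · rintro ⟨i', j', hi, hj, h⟩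
    rw [edge_inj] at h
    rw [h.1, h.2]
    exact ⟨hi, hj⟩
  · exact fun h => ⟨i, j, h.1, h.2, rfl⟩

lemma box_subset (a b c d : α) : box a b c d ⊆ (completeBipartiteGraph α α).edgeSet := by
  rintro _ ⟨i, j, -, -, rfl⟩
  exact edge_mem_edgeSet i j

lemma isSimpleCycleOfLength_box {a b c d : α} (hab : a ≠ b) (hcd : c ≠ d) :
    IsSimpleCycleOfLength (completeBipartiteGraph α α) 4 (box a b c d) := by
  have h : ∀ i j : α, (completeBipartiteGraph α α).Adj (Sum.inl i) (Sum.inr j) := by simp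
  refine ⟨Sum.inl a, .cons (h a c) (.cons (h b c).symm (.cons (h b d) (.cons (h a d).symm .nil))),
    ?_, rfl, ?_⟩
  · rw [SimpleGraph.Walk.cons_isCycle_iff]
    simp [hab, hcd, hab.symm]
  · ext e
    simp only [box, edge, Set.mem_ofPred_eq, SimpleGraph.Walk.edges_cons,
      SimpleGraph.Walk.edges_nil, List.mem_cons, List.not_mem_nil, or_false]
    rw [Sym2.eq_swap (a := Sum.inr c), Sym2.eq_swap (a := Sum.inr d)]
    constructor
    · rintro ⟨i, j, rfl | rfl, rfl | rfl, rfl⟩ <;> simp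
    · rintro (rfl | rfl | rfl | rfl)
      exacts [⟨a, c, .inl rfl, .inl rfl, rfl⟩, ⟨b, c, .inr rfl, .inl rfl, rfl⟩,
        ⟨b, d, .inr rfl, .inr rfl, rfl⟩, ⟨a, d, .inl rfl, .inr rfl, rfl⟩]

lemma vertexDisjoint_box {a b c d a' b' c' d' : α} (h : [a, b, c, d].Nodup)
    (h' : [a', b', c', d'].Nodup) : VertexDisjoint (box a b a' b') (box c d c' d') := by
  simp only [List.nodup_cons, List.mem_cons, List.not_mem_nil] at h h'
  rintro _ ⟨i, j, hi, hj, rfl⟩ _ ⟨k, l, hk, hl, rfl⟩ (v | v)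
  · simp only [inl_mem_edge]; grind
  · simp only [inr_mem_edge]; grind

variable [DecidableEq α]

lemma rect_eq_one_iff {a b c d : α} (h : [a, b, c, d].Nodup) (i k : α) :
    rect a b c d i k = 1 ↔ (i = a ∨ i = b) ∧ (k = c ∨ k = d) := by
  simp only [List.nodup_cons, List.mem_cons, List.not_mem_nil] at h
  unfold rect ind
  grind

lemma hexagon_eq_one_iff {a b c : α} (h : [a, b, c].Nodup) (i k : α) :
    hexagon a b c i k = 1 ↔ i ≠ k ∧ i ∈ [a, b, c] ∧ k ∈ [a, b, c] := by
  simp only [List.nodup_cons, List.mem_cons, List.not_mem_nil] at h ⊢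
  unfold hexagon ind
  have h11 : (1 : ZMod 2) + 1 = 0 := by decide
  grind

lemma cells_tensor_rect {a b c d a' b' c' d' : α} (h : [a, b, c, d].Nodup)
    (h' : [a', b', c', d'].Nodup) :
    cells (tensor (rect a b c d) (rect a' b' c' d')) = box a b a' b' ×ˢ box c d c' d' := by
  refine eq_of_edges (cells_subset _) (Set.prod_mono (box_subset ..) (box_subset ..))
    fun i k j l => ?_
  have hmul : ∀ x y : ZMod 2, x * y = 1 ↔ x = 1 ∧ y = 1 := by decide
  rw [mem_cells, tensor_apply, hmul, rect_eq_one_iff h, rect_eq_one_iff h', Set.mem_prod,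
    edge_mem_box, edge_mem_box]
  tauto

lemma isSymmetrizedTorus_cells {a b c d a' b' c' d' : α} (h : [a, b, c, d].Nodup)
    (h' : [a', b', c', d'].Nodup) :
    IsSymmetrizedTorus (completeBipartiteGraph α α)
      (cells (symmTensor (rect a b c d) (rect a' b' c' d'))) := by
  have rot : ∀ {x y z w : α}, [x, y, z, w].Nodup → x ≠ y ∧ z ≠ w ∧ [z, w, x, y].Nodup := by
    intro x y z w h
    simp only [List.nodup_cons, List.mem_cons, List.not_mem_nil] at h ⊢
    grind
  -- The rectangles in `(i, k)` and in `(j, l)` regroup into one cycle of edges `ij` and one of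
  -- edges `kl`.
  refine ⟨box a b a' b', box c d c' d', isSimpleCycleOfLength_box (rot h).1 (rot h').1,
    isSimpleCycleOfLength_box (rot h).2.1 (rot h').2.1, vertexDisjoint_box h h', ?_⟩
  rw [← cells_tensor_rect h h', ← cells_tensor_rect (rot h).2.2 (rot h').2.2, ← cells_add]
  congr 1
  ext i k j l
  simp only [symmTensor_apply, Pi.add_apply, tensor_apply, rect]
  ring

lemma isDeletedSquareOfK33_cells {a b c a' b' c' : α} (h : [a, b, c].Nodup)
    (h' : [a', b', c'].Nodup) :
    IsDeletedSquareOfK33 (completeBipartiteGraph α α)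
      (cells (tensor (hexagon a b c) (hexagon a' b' c'))) := by
  let u : Fin 3 → α := [a, b, c].get
  let w : Fin 3 → α := [a', b', c'].get
  have hu : Function.Injective u := List.nodup_iff_injective_get.1 h
  have hw : Function.Injective w := List.nodup_iff_injective_get.1 h'
  let φ : SimpleGraph.Copy (completeBipartiteGraph (Fin 3) (Fin 3)) (completeBipartiteGraph α α) :=
    ⟨⟨Sum.map u w, by
      rintro (x | x) (y | y) <;> simp⟩, hu.sumMap hw⟩
  refine ⟨φ.toSubgraph, ⟨φ.isoToSubgraph.symm⟩, ?_⟩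
  have hmem : ∀ i j, edge i j ∈ φ.toSubgraph.edgeSet ↔ i ∈ [a, b, c] ∧ j ∈ [a', b', c'] := by
    intro i j
    rw [List.mem_iff_get, List.mem_iff_get]
    simp only [edge, SimpleGraph.Subgraph.mem_edgeSet, SimpleGraph.Subgraph.map_adj, Relation.Map]
    constructor
    · rintro ⟨x | x, y | y, hxy, hx, hy⟩
      · simp at hxy
      · exact ⟨⟨x, Sum.inl_injective hx⟩, ⟨y, Sum.inr_injective hy⟩⟩
      · exact absurd hx (by simp [φ])
      · simp at hxy
    · rintro ⟨⟨x, hx⟩, ⟨y, hy⟩⟩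
      exact ⟨Sum.inl x, Sum.inr y, by simp, congrArg Sum.inl hx, congrArg Sum.inr hy⟩
  refine eq_of_edges (cells_subset _) ?_ fun i k j l => ?_
  · rintro ⟨σ, τ⟩ ⟨hσ, hτ, -⟩
    exact ⟨φ.toSubgraph.edgeSet_subset hσ, φ.toSubgraph.edgeSet_subset hτ⟩
  · have hmul : ∀ x y : ZMod 2, x * y = 1 ↔ x = 1 ∧ y = 1 := by decide
    rw [mem_cells, tensor_apply, hmul, hexagon_eq_one_iff h, hexagon_eq_one_iff h']
    simp only [deletedSquare, Set.mem_ofPred_eq, hmem, Sum.forall, inl_mem_edge, inr_mem_edge,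
      forall_eq]
    tauto

/-- Addition of indicator functions is the symmetric difference of sets, so an expression of `f`
by generators becomes a sum modulo 2 of tori and deleted squares. -/
lemma exists_list_of_mem_generated {f : α → α → α → α → ZMod 2} (hf : f ∈ generated α) :
    ∃ L : List (Set (Sym2 (α ⊕ α) × Sym2 (α ⊕ α))),
      (∀ T ∈ L, IsSymmetrizedTorus (completeBipartiteGraph α α) T ∨
        IsDeletedSquareOfK33 (completeBipartiteGraph α α) T) ∧ cells f = sumModTwo L := by
  induction hf using AddSubgroup.closure_induction with
  | mem f hf =>
    refine ⟨[cells f], ?_, (symmDiff_bot _).symm⟩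
    rintro _ hT
    rw [List.mem_singleton.1 hT]
    rcases hf with ⟨a, b, c, d, h, a', b', c', d', h', rfl⟩ | ⟨a, b, c, h, a', b', c', h', rfl⟩
    · exact Or.inl (isSymmetrizedTorus_cells h h')
    · exact Or.inr (isDeletedSquareOfK33_cells h h')
  | zero => exact ⟨[], by simp, cells_zero⟩
  | add f g _ _ hf hg =>
    obtain ⟨L, hL, hfL⟩ := hf
    obtain ⟨M, hM, hgM⟩ := hg
    refine ⟨L ++ M, fun T hT => ?_, ?_⟩
    · exact (List.mem_append.1 hT).elim (hL T) (hM T)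
    · rw [cells_add, sumModTwo_append, hfL, hgM]
  | neg f _ hf => rwa [ZModModule.neg_eq_self]

end Graph

/-! ### The indicator function of a cellular cycle -/

section Indicator

variable {α : Type*}

open Classical in
/-- The indicator function of a set of pairs of edges. -/
noncomputable def cellIndicator (C : Set (Sym2 (α ⊕ α) × Sym2 (α ⊕ α))) (i k j l : α) : ZMod 2 :=
  if (edge i j, edge k l) ∈ C then 1 else 0

lemma cellIndicator_eq_zero {C : Set (Sym2 (α ⊕ α) × Sym2 (α ⊕ α))} {i k j l : α}
    (h : (edge i j, edge k l) ∉ C) : cellIndicator C i k j l = 0 := if_neg h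

lemma cells_cellIndicator {C : Set (Sym2 (α ⊕ α) × Sym2 (α ⊕ α))}
    (hC : C ⊆ (completeBipartiteGraph α α).edgeSet ×ˢ (completeBipartiteGraph α α).edgeSet) :
    cells (cellIndicator C) = C :=
  eq_of_edges (cells_subset _) hC fun i k j l => by
    rw [mem_cells, cellIndicator]
    simp

open Classical in
/-- Parity form of a sum of indicator values modulo 2. The set counted may consist of edges that
are parametrized injectively by the summation index. -/
lemma sum_ite_eq_zero_of_even [Fintype α] {P : α → Prop} {S : Set (Sym2 (α ⊕ α))}
    {e : α → Sym2 (α ⊕ α)} (he : Function.Injective e) (hS : S = e '' {x | P x})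
    (h : Even S.ncard) : ∑ x, (if P x then 1 else 0 : ZMod 2) = 0 := by
  rw [hS, Set.ncard_image_of_injective _ he, Set.ncard_eq_toFinset_card'] at h
  rw [sum_boole]
  convert (ZMod.natCast_eq_zero_iff_even).2 h
  ext x
  simp

lemma setOf_inl_mem (i : α) (Q : Sym2 (α ⊕ α) → Prop) :
    {e | e ∈ (completeBipartiteGraph α α).edgeSet ∧ Sum.inl i ∈ e ∧ Q e} =
      (fun j => edge i j) '' {j | Q (edge i j)} := by
  ext e
  constructor
  · rintro ⟨he, hi, hQ⟩
    obtain ⟨i', j, rfl⟩ := mem_edgeSet_iff.1 he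
    rw [inl_mem_edge] at hi
    subst hi
    exact ⟨j, hQ, rfl⟩
  · rintro ⟨j, hQ, rfl⟩
    exact ⟨edge_mem_edgeSet i j, by simp, hQ⟩

lemma setOf_inr_mem (j : α) (Q : Sym2 (α ⊕ α) → Prop) :
    {e | e ∈ (completeBipartiteGraph α α).edgeSet ∧ Sum.inr j ∈ e ∧ Q e} =
      (fun i => edge i j) '' {i | Q (edge i j)} := by
  ext e
  constructor
  · rintro ⟨he, hj, hQ⟩
    obtain ⟨i, j', rfl⟩ := mem_edgeSet_iff.1 he
    rw [inr_mem_edge] at hj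
    subst hj
    exact ⟨i, hQ, rfl⟩
  · rintro ⟨i, hQ, rfl⟩
    exact ⟨edge_mem_edgeSet i j, by simp, hQ⟩

variable [Fintype α] {C : Set (Sym2 (α ⊕ α) × Sym2 (α ⊕ α))}

lemma cellIndicator_mem_balanced (hC : IsCellularTwoCycle (completeBipartiteGraph α α) C)
    (hdel : C ⊆ deletedSquare (completeBipartiteGraph α α).edgeSet) :
    cellIndicator C ∈ balanced α (α → α → ZMod 2) := by
  refine ⟨fun i => ?_, fun i => ?_, fun k => ?_⟩
  · ext j l
    exact cellIndicator_eq_zero fun h =>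
      (hdel h).2.2 (Sum.inl i) (by simp) (by simp)
  · ext j l
    simp only [Finset.sum_apply, Pi.zero_apply]
    exact sum_ite_eq_zero_of_even (fun _ _ h => (edge_inj.1 h).1) (setOf_inr_mem l _)
      (hC.2 (Sum.inr l) _ (edge_mem_edgeSet i j)).2
  · ext j l
    simp only [Finset.sum_apply, Pi.zero_apply]
    exact sum_ite_eq_zero_of_even (fun _ _ h => (edge_inj.1 h).1)
      (setOf_inr_mem j fun e => (e, edge k l) ∈ C)
      (hC.2 (Sum.inr j) _ (edge_mem_edgeSet k l)).1

lemma cellIndicator_apply_mem_balanced (hC : IsCellularTwoCycle (completeBipartiteGraph α α) C)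
    (hdel : C ⊆ deletedSquare (completeBipartiteGraph α α).edgeSet) (i k : α) :
    cellIndicator C i k ∈ balanced α (ZMod 2) := by
  refine ⟨fun j => ?_, fun j => ?_, fun l => ?_⟩
  · exact cellIndicator_eq_zero fun h =>
      (hdel h).2.2 (Sum.inr j) (by simp) (by simp)
  · exact sum_ite_eq_zero_of_even (fun _ _ h => (edge_inj.1 h).2) (setOf_inl_mem k _)
      (hC.2 (Sum.inl k) _ (edge_mem_edgeSet i j)).2
  · exact sum_ite_eq_zero_of_even (fun _ _ h => (edge_inj.1 h).2)
      (setOf_inl_mem i fun e => (e, edge k l) ∈ C)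
      (hC.2 (Sum.inl i) _ (edge_mem_edgeSet k l)).1

end Indicator

end K33Tori

theorem mainTheorem3 (n : ℕ) (C : Set (Sym2 (Fin n ⊕ Fin n) × Sym2 (Fin n ⊕ Fin n)))
    (hC : IsCellularTwoCycle (completeBipartiteGraph (Fin n) (Fin n)) C)
    (hdel : C ⊆ deletedSquare (completeBipartiteGraph (Fin n) (Fin n)).edgeSet)
    (hsymm : IsSymmetricCellSet C) :
    ∃ L : List (Set (Sym2 (Fin n ⊕ Fin n) × Sym2 (Fin n ⊕ Fin n))),
      (∀ T ∈ L, IsSymmetrizedTorus (completeBipartiteGraph (Fin n) (Fin n)) T ∨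
        IsDeletedSquareOfK33 (completeBipartiteGraph (Fin n) (Fin n)) T) ∧
      C = sumModTwo L := by
  have hf : K33Tori.cellIndicator C ∈ K33Tori.generated (Fin n) := by
    refine K33Tori.mem_generated (K33Tori.cellIndicator_mem_balanced hC hdel)
      (K33Tori.cellIndicator_apply_mem_balanced hC hdel) fun i k j l => ?_
    have hswap : ∀ σ τ, (σ, τ) ∈ C → (τ, σ) ∈ C := fun σ τ h => by
      rw [← show Prod.swap '' C = C from hsymm]
      exact ⟨(σ, τ), h, rfl⟩
    have : (K33Tori.edge i j, K33Tori.edge k l) ∈ C ↔ (K33Tori.edge k l, K33Tori.edge i j) ∈ C :=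
      ⟨hswap _ _, hswap _ _⟩
    unfold K33Tori.cellIndicator
    congr 1
    exact propext this
  rw [← K33Tori.cells_cellIndicator hC.1]
  exact K33Tori.exists_list_of_mem_generated hf
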